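/- Let $d\ge 1$, let $S_1,S_2\in\mathbb R^{d\times d}$ be symmetric positive definite, $\bar X,\bar Y\in\mathbb R^d$, $v_1>0$, and consider the Ellipsoidal Mean Estimation Problem (EMEP): minimize $(\bar Y-\mu)^{T}S_2^{-1}(\bar Y-\mu)$ over all $\mu\in\mathbb R^d$ with $(\bar X-\mu)^{T}S_1^{-1}(\bar X-\mu)\le v_1$. A number $\lambda\ge 0$ is a multiplier of the problem if, for some feasible $\mu$, $2S_2^{-1}(\bar Y-\mu)+2\lambda S_1^{-1}(\bar X-\mu)=0$ and $\lambda\big((\bar X-\mu)^{T}S_1^{-1}(\bar X-\mu)-v_1\big)=0$. Put $$\hat\mu(\lambda)=(S_2^{-1}+\lambda S_1^{-1})^{-1}(S_2^{-1}\bar Y+\lambda S_1^{-1}\bar X),\qquad m(\lambda)=(\bar X-\hat\mu(\lambda))^{T}S_1^{-1}(\bar X-\hat\mu(\lambda))-v_1 .$$ Then a number $\lambda>0$ is a multiplier if and only if $m(\lambda)=0$. Assume that a spectral decomposition $S_1^{1/2}S_2^{-1}S_1^{1/2}=PDP^{T}$ ($P$ orthogonal, $D$ diagonal) and the vector $s=P^{T}S_1^{1/2}S_2^{-1}(\bar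 Y-\bar X)$ have been computed; the numbers $D_1,\dots,D_d,s_1,\dots,s_d,v_1$ are given to the algorithm. Let $0<\delta\le b$ and let $\lambda^*$ be a multiplier with $\lambda^*\le b$. Given in addition a number $a$ with $\delta\le a\le\lambda^*$, the algorithm *Binary Search and Newton Method* finds by binary search an interval $[a(1+\tfrac1{12})^{i},a(1+\tfrac1{12})^{i+1}]$ that contains $\lambda^*$, and from $\lambda^0=a(1+\tfrac1{12})^{i}$ computes $\lambda^{k+1}=\lambda^k-m(\lambda^k)/m'(\lambda^k)$ for $k=0,1,2,\dots$ until $k>1+\log_2(1+\max\{0,\log_2(b/\delta)\})$. Its output $\hat\lambda$, the last iterate computed, satisfies $|\lambda^*-\hat\lambda|<\delta$. When no lower bound for $\lambda^*$ is known, the algorithm first tests the sign of $m(\delta)$: if $m(\delta)\ge 0$ it proceeds as above with $a=\delta$, otherwise it returns $\hat\lambda=\delta/2$; again $|\lambda^*-\hat\lambda|<\delta$. In both cases the number of arithmetic operations (additions, subtractions, multiplications, divisions and comparisons of real numbers, loadings of rational constants and loop iterations being counted too) is $O(d\log\log(b/\delta))$. Precisely, for an absolute constant $C>0$ it is at most $C\,d\,\big(1+\log(1+\log(b/\delta))\big)$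 always, and at most $C\,d\,\log\log(b/\delta)$ whenever $b\ge 4\delta$. -/

import Mathlib

open scoped MatrixOrder

noncomputable section

namespace EMEP

/-! ## The ellipsoidal mean estimation problem with respect to `X` at level `v₁` -/

section Problem

variable {d : ℕ}

/-- Squared Mahalanobis distance `(c - μ)ᵀ S⁻¹ (c - μ)`. -/
def mahalanobis (S : Matrix (Fin d) (Fin d) ℝ) (c μ : Fin d → ℝ) : ℝ :=
  (c - μ) ⬝ᵥ (S⁻¹.mulVec (c - μ))

/-- `lam` is a Lagrange multiplier of the problem of minimizing `mahalanobis S₂ ybar μ` over all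
`μ` with `mahalanobis S₁ xbar μ ≤ v₁`: for some `μ` the first order conditions (stationarity,
feasibility, complementary slackness) hold with the nonnegative number `lam`. -/
def IsMultiplier (S₁ S₂ : Matrix (Fin d) (Fin d) ℝ) (xbar ybar : Fin d → ℝ) (v₁ lam : ℝ) : Prop :=
  0 ≤ lam ∧ ∃ μ : Fin d → ℝ,
    (2 : ℝ) • S₂⁻¹.mulVec (ybar - μ) + (2 * lam) • S₁⁻¹.mulVec (xbar - μ) = 0 ∧
    mahalanobis S₁ xbar μ ≤ v₁ ∧
    lam * (mahalanobis S₁ xbar μ - v₁) = 0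

/-- The stationary point `(S₂⁻¹ + lam S₁⁻¹)⁻¹ (S₂⁻¹ ybar + lam S₁⁻¹ xbar)`. -/
def muHat (S₁ S₂ : Matrix (Fin d) (Fin d) ℝ) (xbar ybar : Fin d → ℝ) (lam : ℝ) : Fin d → ℝ :=
  (S₂⁻¹ + lam • S₁⁻¹)⁻¹.mulVec (S₂⁻¹.mulVec ybar + lam • S₁⁻¹.mulVec xbar)

/-- The univariate function whose positive root is sought. -/
def rootFun (S₁ S₂ : Matrix (Fin d) (Fin d) ℝ) (xbar ybar : Fin d → ℝ) (v₁ lam : ℝ) : ℝ :=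
  mahalanobis S₁ xbar (muHat S₁ S₂ xbar ybar lam) - v₁

end Problem

/-- The Newton map `x ↦ x - m x / m' x`. -/
def newtonMap (m : ℝ → ℝ) (x : ℝ) : ℝ := x - m x / deriv m x

/-- Number of Newton steps performed when `lam (k+1)` is computed for `k = 0, 1, 2, …` and the
iteration stops after the first `k` with `k > 1 + log₂ (1 + max {0, log₂ (b / δ)})`. -/
def newtonSteps (b δ : ℝ) : ℕ :=
  ⌊1 + Real.logb 2 (1 + max 0 (Real.logb 2 (b / δ)))⌋₊ + 2

/-! ## A real-number machine with an operation count -/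

/-- The four arithmetic operations. -/
inductive ArithOp
  | add
  | sub
  | mul
  | div

/-- The value of an arithmetic operation on real numbers. -/
def ArithOp.eval : ArithOp → ℝ → ℝ → ℝ
  | .add, x, y => x + y
  | .sub, x, y => x - y
  | .mul, x, y => x * y
  | .div, x, y => x / y

/-- Programs whose numbers have type `V` and whose result has type `α`. A program that is written
for an arbitrary type `V` can handle numbers only through the primitives below: loading a rational
constant, one arithmetic operation, and one comparison. `loop body s k` runs `body` from the state
`s` again and again, until it yields `Sum.inr t`, and continues with `k t`. -/
inductive Prog (V : Type) : Type → Type 1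
  | ret {α : Type} (x : α) : Prog V α
  | lit {α : Type} (q : ℚ) (k : V → Prog V α) : Prog V α
  | op {α : Type} (o : ArithOp) (x y : V) (k : V → Prog V α) : Prog V α
  | le {α : Type} (x y : V) (k : Bool → Prog V α) : Prog V α
  | loop {σ τ α : Type} (body : σ → Prog V (σ ⊕ τ)) (s : σ) (k : τ → Prog V α) : Prog V α

/-- Sequential composition. -/
def Prog.bind {V α β : Type} : Prog V α → (α → Prog V β) → Prog V β
  | .ret x, f => f x
  | .lit q k, f => .lit q (fun v => (k v).bind f)
  | .op o x y k, f => .op o x y (fun v => (k v).bind f)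
  | .le x y k, f => .le x y (fun c => (k c).bind f)
  | .loop body s k, f => .loop body s (fun t => (k t).bind f)

instance {V : Type} : Monad (Prog V) where
  pure := Prog.ret
  bind := Prog.bind

open Classical in
/-- `Runs p y n`: the program `p` on real numbers halts with result `y` after exactly `n`
operations. Every constant, arithmetic operation, comparison and loop iteration costs `1`, and a
division by zero blocks the program. -/
inductive Runs : {α : Type} → Prog ℝ α → α → ℕ → Prop
  | ret {α : Type} (x : α) : Runs (.ret x) x 0
  | lit {α : Type} {q : ℚ} {k : ℝ → Prog ℝ α} {z : α} {n : ℕ} :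
      Runs (k (q : ℝ)) z n → Runs (.lit q k) z (n + 1)
  | op {α : Type} {o : ArithOp} {x y : ℝ} {k : ℝ → Prog ℝ α} {z : α} {n : ℕ} :
      (o = .div → y ≠ 0) → Runs (k (o.eval x y)) z n → Runs (.op o x y k) z (n + 1)
  | le {α : Type} {x y : ℝ} {k : Bool → Prog ℝ α} {z : α} {n : ℕ} :
      Runs (k (decide (x ≤ y))) z n → Runs (.le x y k) z (n + 1)
  | loop_next {σ τ α : Type} {body : σ → Prog ℝ (σ ⊕ τ)} {s s' : σ} {k : τ → Prog ℝ α}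
      {z : α} {n l : ℕ} :
      Runs (body s) (.inl s') n → Runs (.loop body s' k) z l →
        Runs (.loop body s k) z (n + l + 1)
  | loop_exit {σ τ α : Type} {body : σ → Prog ℝ (σ ⊕ τ)} {s : σ} {t : τ} {k : τ → Prog ℝ α}
      {z : α} {n l : ℕ} :
      Runs (body s) (.inr t) n → Runs (k t) z l → Runs (.loop body s k) z (n + l + 1)

/-- Result and operation count of a program are unique. -/
theorem Runs.unique {α : Type} {p : Prog ℝ α} {y₁ : α} {n₁ : ℕ} (h₁ : Runs p y₁ n₁) :
    ∀ {y₂ : α} {n₂ : ℕ}, Runs p y₂ n₂ → y₁ = y₂ ∧ n₁ = n₂ := by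
  induction h₁ with
  | ret x => intro y₂ n₂ h₂; cases h₂; exact ⟨rfl, rfl⟩
  | lit _ ih => intro y₂ n₂ h₂; cases h₂ with | lit h => obtain ⟨h, h'⟩ := ih h; simp [h, h']
  | op _ _ ih => intro y₂ n₂ h₂; cases h₂ with | op _ h => obtain ⟨h, h'⟩ := ih h; simp [h, h']
  | le _ ih => intro y₂ n₂ h₂; cases h₂ with | le h => obtain ⟨h, h'⟩ := ih h; simp [h, h']
  | loop_next _ _ ih₁ ih₂ =>
    intro y₂ n₂ h₂
    cases h₂ with
    | loop_next hb hl =>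
      obtain ⟨h, h'⟩ := ih₁ hb
      cases h
      obtain ⟨h, h''⟩ := ih₂ hl
      simp [h, h', h'']
    | loop_exit hb hl => exact absurd (ih₁ hb).1 (by simp)
  | loop_exit _ _ ih₁ ih₂ =>
    intro y₂ n₂ h₂
    cases h₂ with
    | loop_next hb hl => exact absurd (ih₁ hb).1 (by simp)
    | loop_exit hb hl =>
      obtain ⟨h, h'⟩ := ih₁ hb
      cases h
      obtain ⟨h, h''⟩ := ih₂ hl
      simp [h, h', h'']

end EMEP

end

/-! ## The algorithm -/

namespace EMEP

variable {V : Type}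

/-- Load the rational constant `q`. -/
def const (q : ℚ) : Prog V V := .lit q .ret

/-- Add two numbers. -/
def add (x y : V) : Prog V V := .op .add x y .ret

/-- Subtract two numbers. -/
def sub (x y : V) : Prog V V := .op .sub x y .ret

/-- Multiply two numbers. -/
def mul (x y : V) : Prog V V := .op .mul x y .ret

/-- Divide two numbers. -/
def div (x y : V) : Prog V V := .op .div x y .ret

/-- Compare two numbers. -/
def leq (x y : V) : Prog V Bool := .le x y .ret

/-- Repeat `body` until it yields `Sum.inr`. -/
def iter {σ τ : Type} (body : σ → Prog V (σ ⊕ τ)) (s : σ) : Prog V τ := .loop body s .ret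

/-- From `p`, add to the two accumulators `p.1` and `p.2` the sums, over the indices in the list,
of `s i ^ 2 / (D i + lam) ^ 2` and of `s i ^ 2 / (D i + lam) ^ 3`. -/
def accumulate {d : ℕ} (D s : Fin d → V) (lam : V) : List (Fin d) → V × V → Prog V (V × V)
  | [], p => pure p
  | i :: is, p => do
    let t ← add (D i) lam
    let s2 ← mul (s i) (s i)
    let t2 ← mul t t
    let u ← div s2 t2
    let w ← div u t
    let p1 ← add p.1 u
    let p2 ← add p.2 w
    accumulate D s lam is (p1, p2)

/-- The pair of `m lam = ∑ i, s i ^ 2 / (D i + lam) ^ 2 - v₁` and its derivative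
`m' lam = -2 * ∑ i, s i ^ 2 / (D i + lam) ^ 3`. -/
def evalRoot {d : ℕ} (D s : Fin d → V) (v₁ lam : V) : Prog V (V × V) := do
  let zero ← const 0
  let p ← accumulate D s lam (List.finRange d) (zero, zero)
  let m ← sub p.1 v₁
  let c ← const (-2)
  let m' ← mul c p.2
  pure (m, m')

/-- Whether `m lam ≥ 0`, which means that the root of the decreasing function `m` is not below
`lam`. -/
def rootNotBelow {d : ℕ} (D s : Fin d → V) (v₁ lam : V) : Prog V Bool := do
  let p ← evalRoot D s v₁ lam
  let zero ← const 0
  leq zero p.1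

/-- By repeated squaring, the list `[ρ ^ 2 ^ (J - 1), …, ρ ^ 4, ρ ^ 2, ρ]` for `ρ = 1 + 1 / 12`
and the least `J` with `b ≤ a * ρ ^ 2 ^ J`. -/
def powers (a b : V) : Prog V (List V) := do
  let ρ ← const (1 + 1 / 12)
  iter (fun st : V × List V => do
    let e ← mul a st.1
    if ← leq b e then
      pure (.inr st.2)
    else
      let r ← mul st.1 st.1
      pure (.inl (r, st.1 :: st.2))) (ρ, [])

/-- Binary search on the intervals with left endpoints `x * ρ ^ i`, `i < 2 ^ J`: each comparison of
the middle endpoint with the root halves the range of possible indices. -/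
def bisect {d : ℕ} (D s : Fin d → V) (v₁ : V) : List V → V → Prog V V
  | [], x => pure x
  | r :: rs, x => do
    let y ← mul x r
    if ← rootNotBelow D s v₁ y then
      bisect D s v₁ rs y
    else
      bisect D s v₁ rs x

/-- One Newton step `lam - m lam / m' lam`. -/
def newtonStep {d : ℕ} (D s : Fin d → V) (v₁ lam : V) : Prog V V := do
  let p ← evalRoot D s v₁ lam
  let q ← div p.1 p.2
  sub lam q

/-- The Newton iteration from `lam0`. The number `st.2` is `2 ^ 2 ^ (k - 1)` when `lam (k + 1)` is
computed from `st.1 = lam k`, `k ≥ 1`, and for `b ≥ δ > 0` the inequality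
`2 ^ 2 ^ (k - 1) * δ > 2 * b` is the stopping rule `k > 1 + log₂ (1 + max {0, log₂ (b / δ)})`,
which never holds for `k = 0`. -/
def newton {d : ℕ} (D s : Fin d → V) (v₁ b δ lam0 : V) : Prog V V := do
  let lam1 ← newtonStep D s v₁ lam0
  let two ← const 2
  let bound ← mul two b
  iter (fun st : V × V => do
    let lam ← newtonStep D s v₁ st.1
    let e ← mul st.2 δ
    if ← leq e bound then
      let q ← mul st.2 st.2
      pure (.inl (lam, q))
    else
      pure (.inr lam)) (lam1, two)

/-- Binary search and Newton method, for a root in `[a, b]`. -/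
def binarySearchNewton {d : ℕ} (D s : Fin d → V) (v₁ a b δ : V) : Prog V V := do
  let rs ← powers a b
  let lam0 ← bisect D s v₁ rs a
  newton D s v₁ b δ lam0

/-- The method when no lower bound is known: one evaluation of `m` decides whether `δ` is one. If it
is not, the multiplier lies in `[0, δ)` and `δ / 2` is returned. -/
def solve {d : ℕ} (D s : Fin d → V) (v₁ b δ : V) : Prog V V := do
  if ← rootNotBelow D s v₁ δ then
    binarySearchNewton D s v₁ δ b δ
  else
    let two ← const 2
    div δ two

end EMEP

namespace EMEP

/-! ## Cost semantics -/

/-! Stationarity is a linear system with the positive definite matrix `S₂⁻¹ + l • S₁⁻¹`, which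
eliminates `μ`. In the coordinates `w = Pᵀ S₁^(-1/2) (xbar - muHat)` this system is diagonal, `(D i
+ l) * w i = -s i`, so `m` is the secular function `∑ s i ^ 2 / (D i + l) ^ 2 - v₁`
(`rootFun_eq_secular`). Since all `D i > 0`, it is strictly decreasing and convex for `l ≥ 0` when
`s ≠ 0`, so its sign locates the root.

Newton's method from the left of the root never overshoots, and an error `e` at `x` becomes at most
`3 / (2 * x) * e ^ 2` (`newton_error`). The bound is scale invariant: a start within a factor
`13/12` of the root gives scaled error at most `1/8`, squared at every step. Hence about `log log (b
/ δ)` steps suffice.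

Such a start is found on a geometric grid: about `log (b / δ)` cells, so bisection over their
indices needs about `log log (b / δ)` sign tests. Every evaluation of `m` costs `O(d)`. -/

theorem Runs.bind {α β : Type} {p : Prog ℝ α} {x : α} {n : ℕ} {f : α → Prog ℝ β} {y : β} {k : ℕ}
    (h : Runs p x n) (hf : Runs (f x) y k) : Runs (p >>= f) y (n + k) := by
  change Runs (p.bind f) y (n + k)
  induction h with
  | ret x => simpa [Prog.bind] using hf
  | lit _ ih => rw [add_right_comm]; exact .lit (ih hf)
  | op h _ ih => rw [add_right_comm]; exact .op h (ih hf)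
  | le _ ih => rw [add_right_comm]; exact .le (ih hf)
  | loop_next hb _ _ ih => rw [add_right_comm, add_assoc (_ : ℕ) _ k]; exact .loop_next hb (ih hf)
  | loop_exit hb _ _ ih => rw [add_right_comm, add_assoc (_ : ℕ) _ k]; exact .loop_exit hb (ih hf)

theorem Runs.cast {α : Type} {p : Prog ℝ α} {x y : α} {n k : ℕ} (h : Runs p x n)
    (hxy : x = y) (hnk : n = k) : Runs p y k := hxy ▸ hnk ▸ h

theorem runs_pure {α : Type} (x : α) : Runs (pure x) x 0 := .ret x

theorem runs_const (q : ℚ) : Runs (const q) (q : ℝ) 1 := .lit (.ret _)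

theorem runs_add (x y : ℝ) : Runs (add x y) (x + y) 1 := .op (by simp) (.ret _)

theorem runs_sub (x y : ℝ) : Runs (sub x y) (x - y) 1 := .op (by simp) (.ret _)

theorem runs_mul (x y : ℝ) : Runs (mul x y) (x * y) 1 := .op (by simp) (.ret _)

theorem runs_div (x : ℝ) {y : ℝ} (hy : y ≠ 0) : Runs (div x y) (x / y) 1 :=
  .op (fun _ => hy) (.ret _)

open Classical in
theorem runs_leq (x y : ℝ) : Runs (leq x y) (decide (x ≤ y)) 1 := .le (.ret _)

theorem runs_ite_pos {α : Type} {c : Bool} {p q : Prog ℝ α} {x : α} {n : ℕ} (hc : c = true)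
    (h : Runs p x n) : Runs (if c = true then p else q) x n := by rwa [if_pos hc]

theorem runs_ite_neg {α : Type} {c : Bool} {p q : Prog ℝ α} {x : α} {n : ℕ} (hc : ¬ c = true)
    (h : Runs q x n) : Runs (if c = true then p else q) x n := by rwa [if_neg hc]

/-- A loop that runs through the states `st 0, …, st J` and then exits. -/
theorem runs_iter {σ τ : Type} {body : σ → Prog ℝ (σ ⊕ τ)} (st : ℕ → σ) {t : τ} {c c' : ℕ} :
    ∀ {J : ℕ}, (∀ j < J, Runs (body (st j)) (.inl (st (j + 1))) c) →
      Runs (body (st J)) (.inr t) c' → Runs (iter body (st 0)) t (J * (c + 1) + c' + 1) := by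
  intro J
  induction J generalizing st with
  | zero => intro _ h; exact (Runs.loop_exit h (.ret t)).cast rfl (by omega)
  | succ J ih =>
    intro h h'
    refine (Runs.loop_next (h 0 J.succ_pos)
      (ih (fun j => st (j + 1)) (fun j hj => h (j + 1) (by omega)) h')).cast rfl ?_
    ring

/-! ## The secular function -/

section Secular

variable {d : ℕ}

/-- The function `l ↦ ∑ i, s i ^ 2 / (D i + l) ^ 2 - v`. -/
noncomputable def secular (D s : Fin d → ℝ) (v l : ℝ) : ℝ := ∑ i, s i ^ 2 / (D i + l) ^ 2 - v

/-- The derivative of `secular`. -/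
noncomputable def secularDeriv (D s : Fin d → ℝ) (l : ℝ) : ℝ := -2 * ∑ i, s i ^ 2 / (D i + l) ^ 3

theorem hasDerivAt_secular {D s : Fin d → ℝ} {v l : ℝ} (h : ∀ i, D i + l ≠ 0) :
    HasDerivAt (secular D s v) (secularDeriv D s l) l := by
  have h1 : ∀ i ∈ Finset.univ, HasDerivAt (fun l => s i ^ 2 / (D i + l) ^ 2)
      (-2 * (s i ^ 2 / (D i + l) ^ 3)) l := by
    intro i _
    have h2 : HasDerivAt (fun l => (D i + l) ^ 2) (2 * (D i + l)) l := by
      simpa using ((hasDerivAt_id l).const_add (D i)).fun_pow 2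
    refine ((hasDerivAt_const l (s i ^ 2)).fun_div h2 (pow_ne_zero 2 (h i))).congr_deriv ?_
    have := h i
    field_simp
    ring
  have := (HasDerivAt.fun_sum h1).sub_const v
  rw [← Finset.mul_sum] at this
  exact this

theorem secularDeriv_neg {D s : Fin d → ℝ} {l : ℝ} (hD : ∀ i, 0 < D i + l) (hs : s ≠ 0) :
    secularDeriv D s l < 0 := by
  obtain ⟨i, hi⟩ := Function.ne_iff.1 hs
  have : 0 < ∑ i, s i ^ 2 / (D i + l) ^ 3 :=
    Finset.sum_pos' (fun j _ => div_nonneg (sq_nonneg _) (pow_pos (hD j) 3).le)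
      ⟨i, Finset.mem_univ i, div_pos (sq_pos_of_ne_zero hi) (pow_pos (hD i) 3)⟩
  unfold secularDeriv
  linarith

theorem secular_lt_secular {D s : Fin d → ℝ} {v x y : ℝ} (hD : ∀ i, 0 < D i + x) (hs : s ≠ 0)
    (hxy : x < y) : secular D s v y < secular D s v x := by
  obtain ⟨i, hi⟩ := Function.ne_iff.1 hs
  refine sub_lt_sub_right (Finset.sum_lt_sum (fun j _ => ?_) ⟨i, Finset.mem_univ i, ?_⟩) v
  · have := hD j
    gcongr
  · have := hD i
    have : 0 < s i ^ 2 := sq_pos_of_ne_zero hi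
    gcongr

/-- Strict monotonicity makes the sign test a comparison with the root; this justifies each
bisection decision. -/
theorem secular_nonneg_iff {D s : Fin d → ℝ} {v x l : ℝ} (hD : ∀ i, 0 < D i) (hs : s ≠ 0)
    (hl : 0 ≤ l) (hx : 0 ≤ x) (hroot : secular D s v l = 0) : 0 ≤ secular D s v x ↔ x ≤ l := by
  constructor
  · intro h
    by_contra! hlt
    have := secular_lt_secular (v := v) (fun i => add_pos_of_pos_of_nonneg (hD i) hl) hs hlt
    linarith
  · intro h
    rcases h.eq_or_lt with rfl | hlt
    · exact hroot.ge
    · have := secular_lt_secular (v := v) (fun i => add_pos_of_pos_of_nonneg (hD i) hx) hs hlt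
      linarith

/-- The convex function `x⁻²` lies above its tangent; summed over `i`, this prevents overshooting.
-/
theorem inv_sq_sub_le_inv_sq {x e : ℝ} (hx : 0 < x) (he : 0 ≤ e) :
    1 / x ^ 2 - 2 * e / x ^ 3 ≤ 1 / (x + e) ^ 2 := by
  rw [← sub_nonneg]
  have : 1 / (x + e) ^ 2 - (1 / x ^ 2 - 2 * e / x ^ 3) =
      (3 * e ^ 2 * x + 2 * e ^ 3) / (x ^ 3 * (x + e) ^ 2) := by
    have : x + e ≠ 0 := by positivity
    field_simp
    ring
  rw [this]
  positivity

/-- The second-order Taylor polynomial is an upper bound because the third derivative of `x⁻²` is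
negative; this gives the quadratic rate. -/
theorem inv_sq_le_inv_sq_sub_add {x e : ℝ} (hx : 0 < x) (he : 0 ≤ e) :
    1 / (x + e) ^ 2 ≤ 1 / x ^ 2 - 2 * e / x ^ 3 + 3 * e ^ 2 / x ^ 4 := by
  rw [← sub_nonneg]
  have : 1 / x ^ 2 - 2 * e / x ^ 3 + 3 * e ^ 2 / x ^ 4 - 1 / (x + e) ^ 2 =
      (4 * e ^ 3 * x + 3 * e ^ 4) / (x ^ 4 * (x + e) ^ 2) := by
    have : x + e ≠ 0 := by positivity
    field_simp
    ring
  rw [this]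
  positivity

/-- One Newton step from the left of the root `l` does not pass `l`, and its error is quadratically
small. -/
theorem newton_error {D s : Fin d → ℝ} {v x l : ℝ} (hD : ∀ i, 0 < D i) (hs : s ≠ 0) (hx : 0 < x)
    (hxl : x ≤ l) (hroot : secular D s v l = 0) :
    0 ≤ l - (x - secular D s v x / secularDeriv D s x) ∧
      l - (x - secular D s v x / secularDeriv D s x) ≤ 3 / (2 * x) * (l - x) ^ 2 := by
  have hDx : ∀ i, 0 < D i + x := fun i => add_pos (hD i) hx
  have hneg := secularDeriv_neg hDx hs
  obtain ⟨e, rfl⟩ : ∃ e, l = x + e := ⟨l - x, by ring⟩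
  have he : 0 ≤ e := by linarith
  have hlin : secular D s v x + secularDeriv D s x * e =
      ∑ i, s i ^ 2 * (1 / (D i + x) ^ 2 - 2 * e / (D i + x) ^ 3) - v := by
    simp only [secular, secularDeriv, mul_sub, Finset.sum_sub_distrib, Finset.mul_sum,
      Finset.sum_mul, mul_one_div]
    rw [sub_add_eq_add_sub, ← Finset.sum_add_distrib, ← Finset.sum_sub_distrib]
    congr 1
    refine Finset.sum_congr rfl fun i _ => ?_
    ring
  have hv : ∑ i, s i ^ 2 * (1 / (D i + x + e) ^ 2) = v := by
    simp only [secular, sub_eq_zero] at hroot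
    rw [← hroot]
    refine Finset.sum_congr rfl fun i _ => ?_
    rw [mul_one_div, add_assoc]
  have hle : secular D s v x + secularDeriv D s x * e ≤ 0 := by
    rw [hlin, sub_nonpos, ← hv]
    exact Finset.sum_le_sum fun i _ =>
      mul_le_mul_of_nonneg_left (inv_sq_sub_le_inv_sq (hDx i) he) (sq_nonneg _)
  have hge : 3 / (2 * x) * e ^ 2 * secularDeriv D s x ≤
      secular D s v x + secularDeriv D s x * e := by
    have h1 : v ≤ ∑ i, s i ^ 2 * (1 / (D i + x) ^ 2 - 2 * e / (D i + x) ^ 3) +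
        3 / x * e ^ 2 * ∑ i, s i ^ 2 / (D i + x) ^ 3 := by
      rw [← hv, Finset.mul_sum, ← Finset.sum_add_distrib]
      refine Finset.sum_le_sum fun i _ => ?_
      have h2 := inv_sq_le_inv_sq_sub_add (hDx i) he
      -- One factor `D i + x` is replaced by the smaller `x`, so the remainder is controlled by
      -- `secularDeriv` itself, uniformly in `D` and `s`.
      have h3 : 3 * e ^ 2 / (D i + x) ^ 4 ≤ 3 / x * e ^ 2 / (D i + x) ^ 3 := by
        have h4 : 3 / x * e ^ 2 / (D i + x) ^ 3 = 3 * e ^ 2 / (x * (D i + x) ^ 3) := by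
          field_simp
        have := hDx i
        have h5 : x ≤ D i + x := by linarith [hD i]
        rw [h4, pow_succ' _ 3]
        gcongr
      calc s i ^ 2 * (1 / (D i + x + e) ^ 2)
          ≤ s i ^ 2 * (1 / (D i + x) ^ 2 - 2 * e / (D i + x) ^ 3 +
              3 / x * e ^ 2 / (D i + x) ^ 3) := by gcongr; linarith
        _ = _ := by ring
    rw [hlin]
    have h2 : 3 / (2 * x) * e ^ 2 * secularDeriv D s x =
        -(3 / x * e ^ 2 * ∑ i, s i ^ 2 / (D i + x) ^ 3) := by
      rw [secularDeriv]; field_simp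
    linarith
  -- The new error is the linearization at the root divided by the negative slope, so both bounds
  -- follow from `hle` and `hge`.
  have hq : x + e - (x - secular D s v x / secularDeriv D s x) =
      (secular D s v x + secularDeriv D s x * e) / secularDeriv D s x := by
    field_simp [hneg.ne]
    ring
  rw [hq, add_sub_cancel_left]
  exact ⟨div_nonneg_of_nonpos hle hneg.le, (div_le_iff_of_neg hneg).2 hge⟩

end Secular

/-! ## Execution of the subroutines -/

section Subroutines

variable {d : ℕ} {D s : Fin d → ℝ}

theorem runs_accumulate {l : ℝ} (h : ∀ i, D i + l ≠ 0) : ∀ (is : List (Fin d)) (p : ℝ × ℝ),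
    Runs (accumulate D s l is p)
      (p.1 + (is.map fun i => s i ^ 2 / (D i + l) ^ 2).sum,
        p.2 + (is.map fun i => s i ^ 2 / (D i + l) ^ 3).sum) (7 * is.length)
  | [], p => (runs_pure p).cast (by simp) rfl
  | i :: is, p => by
    refine ((runs_add _ _).bind <| (runs_mul _ _).bind <| (runs_mul _ _).bind <|
      (runs_div _ (mul_ne_zero (h i) (h i))).bind <| (runs_div _ (h i)).bind <|
      (runs_add _ _).bind <| (runs_add _ _).bind <| runs_accumulate h is _).cast ?_ ?_
    · have := h i
      simp only [List.map_cons, List.sum_cons, Prod.mk.injEq]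
      constructor <;> rw [← add_assoc] <;> congr 2 <;> field_simp
    · simp only [List.length_cons]; ring

theorem runs_evalRoot {l : ℝ} (v : ℝ) (h : ∀ i, D i + l ≠ 0) :
    Runs (evalRoot D s v l) (secular D s v l, secularDeriv D s l) (7 * d + 4) := by
  suffices Runs (evalRoot D s v l)
      (((0 : ℚ) : ℝ) + ((List.finRange d).map fun i => s i ^ 2 / (D i + l) ^ 2).sum - v,
        ((-2 : ℚ) : ℝ) * (((0 : ℚ) : ℝ) +
          ((List.finRange d).map fun i => s i ^ 2 / (D i + l) ^ 3).sum))
      (1 + (7 * (List.finRange d).length + (1 + (1 + (1 + 0))))) by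
    refine this.cast ?_ ?_
    · simp [secular, secularDeriv, ← Fin.sum_univ_def]
    · simp only [List.length_finRange]; ring
  refine (runs_const _).bind ?_
  refine (runs_accumulate h _ _).bind ?_
  refine (runs_sub _ _).bind ?_
  refine (runs_const _).bind ?_
  refine (runs_mul _ _).bind ?_
  exact runs_pure _

open Classical in
theorem runs_rootNotBelow {l : ℝ} (v : ℝ) (h : ∀ i, D i + l ≠ 0) :
    Runs (rootNotBelow D s v l) (decide (0 ≤ secular D s v l)) (7 * d + 6) := by
  suffices Runs (rootNotBelow D s v l) (decide (((0 : ℚ) : ℝ) ≤ secular D s v l))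
      (7 * d + 4 + (1 + 1)) from this.cast (by simp) rfl
  exact (runs_evalRoot v h).bind ((runs_const _).bind (runs_leq _ _))

theorem runs_newtonStep {l : ℝ} (v : ℝ) (h : ∀ i, D i + l ≠ 0) (h' : secularDeriv D s l ≠ 0) :
    Runs (newtonStep D s v l) (l - secular D s v l / secularDeriv D s l) (7 * d + 4 + (1 + 1)) := by
  refine (runs_evalRoot v h).bind ?_
  refine (runs_div _ h').bind ?_
  exact runs_sub _ _

/-- The list `[r ^ 2 ^ (J - 1), …, r ^ 4, r ^ 2, r]`. -/
def squarings (r : ℝ) : ℕ → List ℝ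
  | 0 => []
  | J + 1 => r ^ 2 ^ J :: squarings r J

theorem runs_powers {a b : ℝ} {J : ℕ} (hlt : ∀ j < J, a * (1 + 1 / 12) ^ 2 ^ j < b)
    (hle : b ≤ a * (1 + 1 / 12) ^ 2 ^ J) :
    Runs (powers a b) (squarings (1 + 1 / 12) J) (4 * J + 4) := by
  refine ((runs_const _).bind <| ?_ : Runs (powers a b) _ (1 + (J * (3 + 1) + 2 + 1))).cast rfl
    (by ring)
  have h0 : ((((1 + 1 / 12 : ℚ) : ℝ), []) : ℝ × List ℝ) =
      (fun j => (((1 + 1 / 12 : ℝ) ^ 2 ^ j), squarings (1 + 1 / 12) j)) 0 := by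
    simp [squarings]
  rw [h0]
  refine runs_iter (c := 1 + (1 + (1 + 0))) (c' := 1 + (1 + 0))
    (fun j => (((1 + 1 / 12 : ℝ) ^ 2 ^ j), squarings (1 + 1 / 12) j)) ?_ ?_
  · intro j hj
    rw [squarings, pow_succ 2, pow_mul, pow_two]
    refine (runs_mul _ _).bind ?_
    refine (runs_leq _ _).bind ?_
    refine runs_ite_neg (by simpa using hlt j hj) ?_
    refine (runs_mul _ _).bind ?_
    exact runs_pure _
  · refine (runs_mul _ _).bind ?_
    refine (runs_leq _ _).bind ?_
    exact runs_ite_pos (by simpa using hle) (runs_pure _)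

/-- Invariant: the root lies in `[x, x * r ^ 2 ^ J]`. Testing the geometric midpoint halves the
exponent; moving right adds the tested power to the index. -/
theorem runs_bisect {r v l : ℝ} (hD : ∀ i, 0 < D i) (hr : 1 ≤ r)
    (hroot : ∀ y, 0 < y → (0 ≤ secular D s v y ↔ y ≤ l)) :
    ∀ (J : ℕ) {x : ℝ}, 0 < x → x ≤ l → l ≤ x * r ^ 2 ^ J →
      ∃ i : ℕ, Runs (bisect D s v (squarings r J) x) (x * r ^ i) (J * (7 * d + 7)) ∧
        l ∈ Set.Icc (x * r ^ i) (x * r ^ (i + 1))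
  | 0, x, _, hxl, hl => ⟨0, (runs_pure x).cast (by simp) (by simp), by simpa using hxl,
      by simpa using hl⟩
  | J + 1, x, hx, hxl, hl => by
    have hy : 0 < x * r ^ 2 ^ J := by positivity
    have hne : ∀ i, D i + x * r ^ 2 ^ J ≠ 0 := fun i => (add_pos (hD i) hy).ne'
    by_cases h : x * r ^ 2 ^ J ≤ l
    · obtain ⟨i, hi, hi'⟩ := runs_bisect hD hr hroot J hy h
        (by rwa [mul_assoc, ← pow_add, ← mul_two, ← pow_succ])
      simp only [mul_assoc x, ← pow_add] at hi hi'
      refine ⟨2 ^ J + i, ((runs_mul _ _).bind <| (runs_rootNotBelow v hne).bind <|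
        runs_ite_pos ?_ hi).cast rfl (by ring), by simpa [add_assoc] using hi'⟩
      simpa using (hroot _ hy).2 h
    · obtain ⟨i, hi, hi'⟩ := runs_bisect hD hr hroot J hx hxl (not_le.1 h).le
      refine ⟨i, ((runs_mul _ _).bind <| (runs_rootNotBelow v hne).bind <|
        runs_ite_neg ?_ hi).cast rfl (by ring), hi'⟩
      simpa using fun h' => h ((hroot _ hy).1 h')

/-- The Newton program iterates a map `g` that agrees with the Newton step along the orbit. -/
theorem runs_newton {v b δ x : ℝ} {g : ℝ → ℝ} {N : ℕ}
    (hg : ∀ k, Runs (newtonStep D s v (g^[k] x)) (g^[k + 1] x) (7 * d + 6))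
    (hle : ∀ j < N, 2 ^ 2 ^ j * δ ≤ 2 * b) (hlt : 2 * b < 2 ^ 2 ^ N * δ) :
    Runs (newton D s v b δ x) (g^[N + 2] x) ((7 * d + 8) + (N * (7 * d + 10) + (7 * d + 9))) := by
  suffices Runs (newton D s v b δ x) (g^[N + 2] x) ((7 * d + 6) + (1 + (1 +
      (N * ((7 * d + 6 + (1 + (1 + (1 + 0)))) + 1) + (7 * d + 6 + (1 + (1 + 0))) + 1)))) from
    this.cast rfl (by ring)
  refine (hg 0).bind ?_
  refine (runs_const _).bind ?_
  refine (runs_mul _ _).bind ?_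
  -- The first step precedes the loop, so pass `j` starts from iterate `j + 1`; the exiting pass `N`
  -- also takes a step, whence `N + 2`.
  have h0 : ((g^[0 + 1] x, ((2 : ℚ) : ℝ)) : ℝ × ℝ) =
      (fun j => (g^[j + 1] x, (2 : ℝ) ^ 2 ^ j)) 0 := by simp
  rw [h0]
  refine runs_iter (c := 7 * d + 6 + (1 + (1 + (1 + 0)))) (c' := 7 * d + 6 + (1 + (1 + 0)))
    (fun j => (g^[j + 1] x, (2 : ℝ) ^ 2 ^ j)) ?_ ?_
  · intro j hj
    rw [pow_succ 2, pow_mul, pow_two ((2 : ℝ) ^ 2 ^ j)]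
    refine (hg (j + 1)).bind ?_
    refine (runs_mul _ _).bind ?_
    refine (runs_leq _ _).bind ?_
    refine runs_ite_pos (by simpa using hle j hj) ?_
    refine (runs_mul _ _).bind ?_
    exact runs_pure _
  · refine (hg (N + 1)).bind ?_
    refine (runs_mul _ _).bind ?_
    refine (runs_leq _ _).bind ?_
    exact runs_ite_neg (by simpa using hlt) (runs_pure _)

end Subroutines

/-! ## Multipliers and the secular function -/

section Multipliers

variable {d : ℕ} {S₁ S₂ P : Matrix (Fin d) (Fin d) ℝ} {D s xbar ybar : Fin d → ℝ} {v₁ l : ℝ}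

theorem sqrt_mul_sqrt (h : S₁.PosDef) : CFC.sqrt S₁ * CFC.sqrt S₁ = S₁ :=
  CFC.sqrt_mul_sqrt_self S₁ (Matrix.nonneg_iff_posSemidef.2 h.posSemidef)

theorem posDef_sqrt (h : S₁.PosDef) : (CFC.sqrt S₁).PosDef := by
  have h0 := Matrix.nonneg_iff_posSemidef.1 (CFC.sqrt_nonneg S₁)
  rw [h0.posDef_iff_isUnit]
  exact (CFC.isUnit_sqrt_iff S₁ (Matrix.nonneg_iff_posSemidef.2 h.posSemidef)).2 h.isUnit

/-- Positive definiteness survives congruence by `S₁^(1/2)` and by `P`. It keeps every denominator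
`D i + l` positive for `l ≥ 0`. -/
theorem diagonal_pos (h₁ : S₁.PosDef) (h₂ : S₂.PosDef) (hP : P ∈ Matrix.orthogonalGroup (Fin d) ℝ)
    (hdec : CFC.sqrt S₁ * S₂⁻¹ * CFC.sqrt S₁ = P * Matrix.diagonal D * P.transpose) (i : Fin d) :
    0 < D i := by
  have hA := posDef_sqrt h₁
  have h : (CFC.sqrt S₁ * S₂⁻¹ * CFC.sqrt S₁).PosDef := by
    have := (Matrix.IsUnit.posDef_star_right_conjugate_iff (x := S₂⁻¹) hA.isUnit).2 h₂.inv
    rwa [Matrix.star_eq_conjTranspose, hA.isHermitian.eq] at this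
  rw [hdec] at h
  have hPu : IsUnit P := ⟨Unitary.toUnits ⟨P, hP⟩, rfl⟩
  have := (Matrix.IsUnit.posDef_star_right_conjugate_iff (x := Matrix.diagonal D) hPu).1 h
  exact Matrix.posDef_diagonal_iff.1 this i

theorem isUnit_inv_add_smul_inv (h₁ : S₁.PosDef) (h₂ : S₂.PosDef) (hl : 0 ≤ l) :
    IsUnit (S₂⁻¹ + l • S₁⁻¹) :=
  (h₂.inv.add_posSemidef (h₁.inv.posSemidef.smul hl)).isUnit

theorem mulVec_muHat (h₁ : S₁.PosDef) (h₂ : S₂.PosDef) (hl : 0 ≤ l) :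
    (S₂⁻¹ + l • S₁⁻¹).mulVec (muHat S₁ S₂ xbar ybar l) =
      S₂⁻¹.mulVec ybar + l • S₁⁻¹.mulVec xbar := by
  have := (Matrix.isUnit_iff_isUnit_det _).1 (isUnit_inv_add_smul_inv h₁ h₂ hl)
  rw [muHat, Matrix.mulVec_mulVec, Matrix.mul_nonsing_inv _ this, Matrix.one_mulVec]

theorem stationary_iff_eq_muHat (h₁ : S₁.PosDef) (h₂ : S₂.PosDef) (hl : 0 ≤ l) (μ : Fin d → ℝ) :
    (2 : ℝ) • S₂⁻¹.mulVec (ybar - μ) + (2 * l) • S₁⁻¹.mulVec (xbar - μ) = 0 ↔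
      μ = muHat S₁ S₂ xbar ybar l := by
  have hinj := Matrix.mulVec_injective_of_isUnit (isUnit_inv_add_smul_inv h₁ h₂ hl)
  rw [← hinj.eq_iff (a := μ), mulVec_muHat h₁ h₂ hl, mul_smul, ← smul_add, smul_eq_zero_iff_right two_ne_zero,
    Matrix.mulVec_sub, Matrix.mulVec_sub, Matrix.add_mulVec, Matrix.smul_mulVec, smul_sub,
    sub_add_sub_comm, sub_eq_zero, eq_comm]

theorem isMultiplier_iff (h₁ : S₁.PosDef) (h₂ : S₂.PosDef) :
    IsMultiplier S₁ S₂ xbar ybar v₁ l ↔ 0 ≤ l ∧ rootFun S₁ S₂ xbar ybar v₁ l ≤ 0 ∧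
      l * rootFun S₁ S₂ xbar ybar v₁ l = 0 := by
  refine and_congr_right fun hl => ?_
  simp only [stationary_iff_eq_muHat h₁ h₂ hl, exists_eq_left, rootFun, sub_nonpos]

theorem isMultiplier_iff_of_pos (h₁ : S₁.PosDef) (h₂ : S₂.PosDef) (hl : 0 < l) :
    IsMultiplier S₁ S₂ xbar ybar v₁ l ↔ rootFun S₁ S₂ xbar ybar v₁ l = 0 := by
  rw [isMultiplier_iff h₁ h₂]
  constructor
  · rintro ⟨-, -, h⟩
    exact (mul_eq_zero.1 h).resolve_left hl.ne'
  · intro h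
    exact ⟨hl.le, h.le, by rw [h, mul_zero]⟩

theorem rootFun_eq_secular (h₁ : S₁.PosDef) (h₂ : S₂.PosDef)
    (hP : P ∈ Matrix.orthogonalGroup (Fin d) ℝ)
    (hdec : CFC.sqrt S₁ * S₂⁻¹ * CFC.sqrt S₁ = P * Matrix.diagonal D * P.transpose)
    (hs : s = P.transpose.mulVec ((CFC.sqrt S₁ * S₂⁻¹).mulVec (ybar - xbar))) (hl : 0 ≤ l) :
    rootFun S₁ S₂ xbar ybar v₁ l = secular D s v₁ l := by
  have hD := diagonal_pos h₁ h₂ hP hdec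
  have hPP : P.transpose * P = 1 := Matrix.mem_orthogonalGroup_iff' _ _ |>.1 hP
  have hPP' : P * P.transpose = 1 := Matrix.mem_orthogonalGroup_iff _ _ |>.1 hP
  have hA := posDef_sqrt h₁
  have hAA := sqrt_mul_sqrt h₁
  set A := CFC.sqrt S₁
  have hAdet := (Matrix.isUnit_iff_isUnit_det _).1 hA.isUnit
  have hAt : A⁻¹.transpose = A⁻¹ := by simpa using hA.inv.isHermitian.eq
  have hS : S₁⁻¹ = A⁻¹ * A⁻¹ := by rw [← hAA, Matrix.mul_inv_rev]
  set u := xbar - muHat S₁ S₂ xbar ybar l with hu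
  have hMu : (S₂⁻¹ + l • S₁⁻¹).mulVec u = S₂⁻¹.mulVec (xbar - ybar) := by
    rw [hu, Matrix.mulVec_sub, mulVec_muHat h₁ h₂ hl, Matrix.add_mulVec, Matrix.smul_mulVec,
      Matrix.mulVec_sub]
    abel
  -- The congruence by `A = S₁^(1/2)` turns `S₁⁻¹` into the identity, so `P` diagonalizes both terms
  -- at once.
  have hM : P.transpose * A * (S₂⁻¹ + l • S₁⁻¹) * A =
      Matrix.diagonal (fun i => D i + l) * P.transpose := by
    have h3 : A * (S₂⁻¹ + l • S₁⁻¹) * A = P * Matrix.diagonal D * P.transpose + l • 1 := by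
      rw [mul_add, add_mul, hdec, hS, mul_smul_comm, smul_mul_assoc, ← mul_assoc,
        Matrix.mul_nonsing_inv _ hAdet, one_mul, Matrix.nonsing_inv_mul _ hAdet]
    have h4 : Matrix.diagonal (fun i => D i + l) = Matrix.diagonal D + l • 1 := by
      rw [← Matrix.diagonal_one, ← Matrix.diagonal_smul, Matrix.diagonal_add]
      simp
    rw [mul_assoc, mul_assoc, ← mul_assoc A, h3, h4, mul_add, add_mul, ← mul_assoc, ← mul_assoc,
      hPP, one_mul, mul_smul_comm, mul_one, smul_mul_assoc, one_mul]
  set w := P.transpose.mulVec (A⁻¹.mulVec u) with hw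
  have hDw : (Matrix.diagonal fun i => D i + l).mulVec w = -s := by
    rw [hw, Matrix.mulVec_mulVec, ← hM, Matrix.mulVec_mulVec, mul_assoc _ A A⁻¹,
      Matrix.mul_nonsing_inv _ hAdet, mul_one, ← Matrix.mulVec_mulVec, hMu, hs, ← Matrix.mulVec_neg,
      ← Matrix.mulVec_neg, neg_sub]
    simp only [Matrix.mulVec_mulVec, mul_assoc]
  have hwi : ∀ i, w i = -s i / (D i + l) := by
    intro i
    have := congrFun hDw i
    rw [Matrix.mulVec_diagonal, Pi.neg_apply] at this
    rw [← this, mul_div_cancel_left₀ _ (add_pos_of_pos_of_nonneg (hD i) hl).ne']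
  have hmah : mahalanobis S₁ xbar (muHat S₁ S₂ xbar ybar l) = w ⬝ᵥ w := by
    rw [mahalanobis, ← hu, hS, hw, Matrix.dotProduct_mulVec (P.transpose.mulVec _),
      Matrix.vecMul_transpose, Matrix.mulVec_mulVec, hPP', Matrix.one_mulVec,
      ← Matrix.mulVec_mulVec, Matrix.dotProduct_mulVec u, ← Matrix.mulVec_transpose, hAt]
  rw [rootFun, hmah, secular]
  congr 1
  refine Finset.sum_congr rfl fun i _ => ?_
  rw [hwi, div_mul_div_comm, neg_mul_neg, pow_two, pow_two]

end Multipliers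

/-! ## Convergence and operation counts -/

section Analysis

variable {d : ℕ} {D s : Fin d → ℝ} {v l : ℝ}

/-- The iterates increase towards `l`, so the factor `3 / (2 * y)` at a later iterate `y` is at most
that at the start `x`, and the error scaled by the latter is squared at every step. -/
theorem newton_iterate_error (hD : ∀ i, 0 < D i) (hs : s ≠ 0) (hroot : secular D s v l = 0)
    {g : ℝ → ℝ} (hg : ∀ y, 0 < y → g y = y - secular D s v y / secularDeriv D s y) {x : ℝ}
    (hx : 0 < x) (hxl : l ∈ Set.Icc x (x * (1 + 1 / 12))) (k : ℕ) :
    x ≤ g^[k] x ∧ g^[k] x ≤ l ∧ 3 / (2 * x) * (l - g^[k] x) ≤ (1 / 8) ^ 2 ^ k := by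
  induction k with
  | zero =>
    refine ⟨le_rfl, hxl.1, ?_⟩
    -- The grid ratio enters here: `3/2 * 1/12 = 1/8`.
    have h : l - x ≤ x / 12 := by linarith [hxl.2]
    calc 3 / (2 * x) * (l - x) ≤ 3 / (2 * x) * (x / 12) := by gcongr
      _ = (1 / 8) ^ 2 ^ 0 := by field_simp; norm_num
  | succ k ih =>
    obtain ⟨h1, h2, h3⟩ := ih
    rw [Function.iterate_succ_apply']
    set y := g^[k] x
    have hy : 0 < y := hx.trans_le h1
    have hneg := secularDeriv_neg (fun i => add_pos (hD i) hy) hs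
    have hpos := (secular_nonneg_iff hD hs (hy.le.trans h2) hy.le hroot).2 h2
    obtain ⟨h4, h5⟩ := newton_error hD hs hy h2 hroot
    rw [← hg y hy] at h4 h5
    refine ⟨h1.trans ?_, by linarith, ?_⟩
    · rw [hg y hy]
      linarith [div_nonpos_of_nonneg_of_nonpos hpos hneg.le]
    · have h6 : 0 ≤ l - y := by linarith
      calc 3 / (2 * x) * (l - g y) ≤ 3 / (2 * x) * (3 / (2 * x) * (l - y) ^ 2) := by
            gcongr
            refine h5.trans ?_
            gcongr
        _ = (3 / (2 * x) * (l - y)) ^ 2 := by ring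
        _ ≤ ((1 / 8) ^ 2 ^ k) ^ 2 := by gcongr
        _ = (1 / 8) ^ 2 ^ (k + 1) := by rw [← pow_mul, ← pow_succ]

theorem newton_error_lt (hD : ∀ i, 0 < D i) (hs : s ≠ 0) (hroot : secular D s v l = 0)
    {g : ℝ → ℝ} (hg : ∀ y, 0 < y → g y = y - secular D s v y / secularDeriv D s y) {x b δ : ℝ}
    (hx : 0 < x) (hxl : l ∈ Set.Icc x (x * (1 + 1 / 12))) (hlb : l ≤ b) {N : ℕ}
    (hN : 2 * b < 2 ^ 2 ^ N * δ) : |l - g^[N + 2] x| < δ := by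
  obtain ⟨-, h2, h3⟩ := newton_iterate_error hD hs hroot hg hx hxl (N + 2)
  rw [abs_of_nonneg (by linarith)]
  have hb : 0 < b := hx.trans_le (hxl.1.trans hlb)
  have h4 : ((1 : ℝ) / 8) ^ 2 ^ (N + 2) ≤ 1 / 2 ^ 2 ^ N := by
    rw [div_pow, one_pow]
    refine one_div_le_one_div_of_le (by positivity) ?_
    calc (2 : ℝ) ^ 2 ^ N ≤ 8 ^ 2 ^ N := by gcongr; norm_num
      _ ≤ 8 ^ 2 ^ (N + 2) := by gcongr <;> simp
  have h5 : l - g^[N + 2] x = 2 * x / 3 * (3 / (2 * x) * (l - g^[N + 2] x)) := by field_simp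
  rw [h5]
  calc 2 * x / 3 * (3 / (2 * x) * (l - g^[N + 2] x)) ≤ 2 * x / 3 * (1 / 2 ^ 2 ^ N) := by
        gcongr
        exact h3.trans h4
    _ ≤ 2 * b * (1 / 2 ^ 2 ^ N) := by
        gcongr
        linarith [hxl.1]
    _ < δ := by rwa [mul_one_div, div_lt_iff₀ (by positivity), mul_comm δ]

/-- Taking base-2 logarithms twice translates the stopping rule into the comparison that the program
makes by repeated squaring. -/
theorem two_pow_two_pow_le_iff {t : ℝ} (ht : 1 ≤ t) (j : ℕ) :
    (2 : ℝ) ^ 2 ^ j ≤ 2 * t ↔ (j : ℝ) ≤ Real.logb 2 (1 + Real.logb 2 t) := by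
  have h0 : 0 ≤ Real.logb 2 t := Real.logb_nonneg (by norm_num) ht
  rw [Real.le_logb_iff_rpow_le (by norm_num) (by linarith), Real.rpow_natCast]
  have h1 : 1 + Real.logb 2 t = Real.logb 2 (2 * t) := by
    rw [Real.logb_mul (by norm_num) (by linarith), Real.logb_self_eq_one (by norm_num)]
  rw [h1, Real.le_logb_iff_rpow_le (by norm_num) (by linarith)]
  rw [show ((2 : ℝ) ^ j) = ((2 ^ j : ℕ) : ℝ) by push_cast; rfl, Real.rpow_natCast]

theorem newtonSteps_spec {b δ : ℝ} (hδ : 0 < δ) (hb : δ ≤ b) :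
    ∃ N, newtonSteps b δ = N + 2 ∧ (∀ j < N, 2 ^ 2 ^ j * δ ≤ 2 * b) ∧
      2 * b < 2 ^ 2 ^ N * δ ∧ (N : ℝ) ≤ 2 * (1 + Real.log (1 + Real.log (b / δ))) := by
  have ht : 1 ≤ b / δ := (one_le_div hδ).2 hb
  have hL : 0 ≤ Real.logb 2 (b / δ) := Real.logb_nonneg (by norm_num) ht
  have hl : 0 ≤ Real.log (b / δ) := Real.log_nonneg ht
  have hiff : ∀ j : ℕ, 2 ^ 2 ^ j * δ ≤ 2 * b ↔
      (j : ℝ) ≤ Real.logb 2 (1 + Real.logb 2 (b / δ)) := by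
    intro j
    rw [← two_pow_two_pow_le_iff ht, ← le_div_iff₀ hδ, mul_div_assoc]
  have hL' : 0 ≤ Real.logb 2 (1 + Real.logb 2 (b / δ)) :=
    Real.logb_nonneg (by norm_num) (by linarith)
  refine ⟨_, rfl, ?_, ?_, ?_⟩ <;> rw [max_eq_right hL]
  · intro j hj
    rw [hiff]
    have := (Nat.le_floor_iff (by linarith)).1 (Nat.succ_le_of_lt hj)
    push_cast at this
    linarith
  · rw [← not_le, hiff, not_le]
    linarith [Nat.lt_floor_add_one (1 + Real.logb 2 (1 + Real.logb 2 (b / δ)))]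
  · refine (Nat.floor_le (by linarith)).trans ?_
    -- Passing from base 2 to natural logarithms costs at most a factor 2.
    have h2 : (1 : ℝ) / 2 < Real.log 2 := by linarith [Real.log_two_gt_d9]
    have h3 : Real.logb 2 (b / δ) ≤ 2 * Real.log (b / δ) := by
      rw [Real.logb, div_le_iff₀ (by linarith)]
      nlinarith
    have h4 : Real.log (1 + Real.logb 2 (b / δ)) ≤ Real.log 2 + Real.log (1 + Real.log (b / δ)) := by
      rw [← Real.log_mul (by norm_num) (by linarith)]
      exact Real.log_le_log (by linarith) (by linarith)
    have h5 : 0 ≤ Real.log (1 + Real.log (b / δ)) := Real.log_nonneg (by linarith)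
    have h6 : Real.logb 2 (1 + Real.logb 2 (b / δ)) ≤
        1 + 2 * Real.log (1 + Real.log (b / δ)) := by
      rw [Real.logb, div_le_iff₀ (by linarith)]
      nlinarith
    linarith

/-- Take the least `J`. If `J = K + 1`, minimality gives `(13/12) ^ 2 ^ K < b / a ≤ b / δ`, and two
logarithms bound `K`. -/
theorem exists_squarings_length {a b δ : ℝ} (hδ : 0 < δ) (ha : δ ≤ a) (hb : δ ≤ b) :
    ∃ J : ℕ, (∀ j < J, a * (1 + 1 / 12) ^ 2 ^ j < b) ∧ b ≤ a * (1 + 1 / 12) ^ 2 ^ J ∧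
      (J : ℝ) ≤ 5 * (1 + Real.log (1 + Real.log (b / δ))) := by
  have ha0 : 0 < a := hδ.trans_le ha
  have hl : 0 ≤ Real.log (b / δ) := Real.log_nonneg ((one_le_div hδ).2 hb)
  have hG : 0 ≤ Real.log (1 + Real.log (b / δ)) := Real.log_nonneg (by linarith)
  have hex : ∃ J : ℕ, b ≤ a * (1 + 1 / 12 : ℝ) ^ 2 ^ J := by
    obtain ⟨n, hn⟩ := pow_unbounded_of_one_lt (b / a) (by norm_num : (1 : ℝ) < 1 + 1 / 12)
    refine ⟨n, ?_⟩
    rw [← div_le_iff₀' ha0]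
    exact hn.le.trans (pow_le_pow_right₀ (by norm_num) Nat.lt_two_pow_self.le)
  classical
  refine ⟨Nat.find hex, fun j hj => not_le.1 (Nat.find_min hex hj), Nat.find_spec hex, ?_⟩
  rcases hJ : Nat.find hex with _ | K
  · push_cast; linarith
  · have h1 : a * (1 + 1 / 12) ^ 2 ^ K < b := not_le.1 (Nat.find_min hex (by omega))
    have h2 : (1 + 1 / 12 : ℝ) ^ 2 ^ K ≤ b / δ := by
      rw [le_div_iff₀' hδ]
      exact (mul_le_mul_of_nonneg_right ha (by positivity)).trans h1.le
    have h3 := Real.log_le_log (by positivity) h2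
    rw [Real.log_pow] at h3
    have h4 : (1 : ℝ) / 13 ≤ Real.log (1 + 1 / 12) := by
      have := Real.one_sub_inv_le_log_of_pos (by norm_num : (0 : ℝ) < 1 + 1 / 12)
      norm_num at this ⊢
      exact this
    push_cast at h3
    -- The factor 13 from `h4` is rounded up to `2 ^ 4`.
    have h5 : (2 : ℝ) ^ K ≤ 2 ^ 4 * (1 + Real.log (b / δ)) := by
      have : (2 : ℝ) ^ K * (1 / 13) ≤ 2 ^ K * Real.log (1 + 1 / 12) := by gcongr
      linarith
    have h6 := Real.log_le_log (by positivity) h5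
    rw [Real.log_mul (by norm_num) (by linarith), Real.log_pow, Real.log_pow] at h6
    have h7 : (1 : ℝ) / 2 < Real.log 2 := by linarith [Real.log_two_gt_d9]
    push_cast at h6 ⊢
    have h8 : ((K : ℝ) - 4) * Real.log 2 ≤ Real.log (1 + Real.log (b / δ)) := by linarith
    rcases le_total (K : ℝ) 4 with h | h
    · linarith
    · nlinarith

/-- With `t = log (b / δ) ≥ log 4 > 4/3`, one has `1 + t ≤ 2 * t` and `log t ≥ 1/4`, so the constant
`1 + log 2` is absorbed by `7 * log t`. -/
theorem one_add_log_le {b δ : ℝ} (hδ : 0 < δ) (hb : 4 * δ ≤ b) :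
    1 + Real.log (1 + Real.log (b / δ)) ≤ 8 * Real.log (Real.log (b / δ)) := by
  have h1 : 2 * Real.log 2 ≤ Real.log (b / δ) := by
    rw [← Real.log_rpow (by norm_num)]
    refine Real.log_le_log (by positivity) ?_
    rw [le_div_iff₀ hδ]
    norm_num
    exact hb
  have h2 := Real.log_two_gt_d9
  have h3 := Real.log_two_lt_d9
  set t := Real.log (b / δ)
  have ht : 4 / 3 ≤ t := by linarith
  have h4 : Real.log (1 + t) ≤ Real.log 2 + Real.log t := by
    rw [← Real.log_mul (by norm_num) (by linarith)]
    exact Real.log_le_log (by linarith) (by linarith)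
  have h5 : 1 / 4 ≤ Real.log t := by
    refine le_trans ?_ (Real.one_sub_inv_le_log_of_pos (by linarith))
    have : t⁻¹ ≤ (4 / 3)⁻¹ := by gcongr
    norm_num at this ⊢
    linarith
  linarith

theorem runs_binarySearchNewton (hd : 1 ≤ d) (hD : ∀ i, 0 < D i) (hs : s ≠ 0)
    (hroot : secular D s v l = 0) {g : ℝ → ℝ}
    (hg : ∀ y, 0 < y → g y = y - secular D s v y / secularDeriv D s y) {a b δ : ℝ} (hδ : 0 < δ)
    (ha : δ ≤ a) (hal : a ≤ l) (hlb : l ≤ b) :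
    ∃ n i : ℕ, Runs (binarySearchNewton D s v a b δ)
        (g^[newtonSteps b δ] (a * (1 + 1 / 12) ^ i)) n ∧
      l ∈ Set.Icc (a * (1 + 1 / 12) ^ i) (a * (1 + 1 / 12) ^ (i + 1)) ∧
      |l - g^[newtonSteps b δ] (a * (1 + 1 / 12) ^ i)| < δ ∧
      (n : ℝ) ≤ 160 * d * (1 + Real.log (1 + Real.log (b / δ))) := by
  have hb : δ ≤ b := ha.trans (hal.trans hlb)
  have ha0 : 0 < a := hδ.trans_le ha
  obtain ⟨N, hN, hle, hlt, hNle⟩ := newtonSteps_spec hδ hb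
  obtain ⟨J, hJlt, hJle, hJ⟩ := exists_squarings_length hδ ha hb
  obtain ⟨i, hi, hi'⟩ := runs_bisect (v := v) hD (by norm_num : (1 : ℝ) ≤ 1 + 1 / 12)
    (fun y hy => secular_nonneg_iff hD hs (ha0.le.trans hal) hy.le hroot) J ha0 hal
    (hlb.trans hJle)
  have hx : 0 < a * (1 + 1 / 12) ^ i := by positivity
  have hi'' := hi'
  rw [pow_succ, ← mul_assoc] at hi''
  have hstep : ∀ k, Runs (newtonStep D s v (g^[k] (a * (1 + 1 / 12) ^ i)))
      (g^[k + 1] (a * (1 + 1 / 12) ^ i)) (7 * d + 6) := by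
    intro k
    -- Iterates stay positive, so no division by zero blocks the run.
    have hy := hx.trans_le (newton_iterate_error hD hs hroot hg hx hi'' k).1
    have hne := fun i => add_pos (hD i) hy
    rw [Function.iterate_succ_apply', hg _ hy]
    exact runs_newtonStep v (fun i => (hne i).ne') (secularDeriv_neg hne hs).ne
  rw [hN]
  refine ⟨_, i, (runs_powers hJlt hJle).bind (hi.bind (runs_newton hstep hle hlt)), hi',
    newton_error_lt hD hs hroot hg hx hi'' hlb hlt, ?_⟩
  push_cast
  have hd' : (1 : ℝ) ≤ d := by exact_mod_cast hd
  have hG : 0 ≤ Real.log (1 + Real.log (b / δ)) :=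
    Real.log_nonneg (by linarith [Real.log_nonneg ((one_le_div hδ).2 hb)])
  set G := Real.log (1 + Real.log (b / δ))
  have h1 : (J : ℝ) * (7 * d + 11) ≤ 5 * (1 + G) * (18 * d) := by gcongr; linarith
  have h2 : (N : ℝ) * (7 * d + 10) ≤ 2 * (1 + G) * (17 * d) := by gcongr; linarith
  have h3 : (0 : ℝ) ≤ d * G := by positivity
  linarith

end Analysis

end EMEP

theorem theoremB1 :
    ∃ C : ℝ, 0 < C ∧
      ∀ (d : ℕ) (_ : 1 ≤ d) (S₁ S₂ : Matrix (Fin d) (Fin d) ℝ) (_ : S₁.PosDef) (_ : S₂.PosDef)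
        (xbar ybar : Fin d → ℝ) (v₁ : ℝ) (_ : 0 < v₁)
        (P : Matrix (Fin d) (Fin d) ℝ) (D s : Fin d → ℝ)
        (_ : P ∈ Matrix.orthogonalGroup (Fin d) ℝ)
        (_ : CFC.sqrt S₁ * S₂⁻¹ * CFC.sqrt S₁ = P * Matrix.diagonal D * P.transpose)
        (_ : s = P.transpose.mulVec ((CFC.sqrt S₁ * S₂⁻¹).mulVec (ybar - xbar))),
        -- the positive multipliers are the positive roots of the univariate function
        (∀ l : ℝ, 0 < l →
          (EMEP.IsMultiplier S₁ S₂ xbar ybar v₁ l ↔ EMEP.rootFun S₁ S₂ xbar ybar v₁ l = 0)) ∧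
        ∀ (lam b δ : ℝ), EMEP.IsMultiplier S₁ S₂ xbar ybar v₁ lam → lam ≤ b → 0 < δ → δ ≤ b →
          -- the algorithm with a lower bound `a ≥ δ` and the upper bound `b`
          (∀ a : ℝ, δ ≤ a → a ≤ lam →
            ∃ (lamHat : ℝ) (n : ℕ),
              EMEP.Runs (EMEP.binarySearchNewton D s v₁ a b δ) lamHat n ∧
              |lam - lamHat| < δ ∧
              (n : ℝ) ≤ C * d * (1 + Real.log (1 + Real.log (b / δ))) ∧
              (4 * δ ≤ b → (n : ℝ) ≤ C * d * Real.log (Real.log (b / δ))) ∧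
              ∃ i : ℕ,
                lam ∈ Set.Icc (a * (1 + 1 / 12) ^ i) (a * (1 + 1 / 12) ^ (i + 1)) ∧
                lamHat = (EMEP.newtonMap (EMEP.rootFun S₁ S₂ xbar ybar v₁))^[EMEP.newtonSteps b δ]
                  (a * (1 + 1 / 12) ^ i)) ∧
          -- the algorithm with the upper bound `b` alone
          (∃ (lamHat : ℝ) (n : ℕ),
            EMEP.Runs (EMEP.solve D s v₁ b δ) lamHat n ∧
            |lam - lamHat| < δ ∧
            (n : ℝ) ≤ C * d * (1 + Real.log (1 + Real.log (b / δ))) ∧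
            (4 * δ ≤ b → (n : ℝ) ≤ C * d * Real.log (Real.log (b / δ)))) := by
  -- `1440 = 8 * 180`: the 8 is from `one_add_log_le`, and 180 leaves room for the initial sign test
  -- beyond the 160 of `runs_binarySearchNewton`.
  refine ⟨1440, by norm_num, ?_⟩
  intro d hd S₁ S₂ h₁ h₂ xbar ybar v₁ hv P D s hP hdec hs
  refine ⟨fun l hl => EMEP.isMultiplier_iff_of_pos h₁ h₂ hl, ?_⟩
  intro lam b δ hlam hlb hδ hδb
  have hD := EMEP.diagonal_pos h₁ h₂ hP hdec
  have heq : ∀ y, 0 ≤ y → EMEP.rootFun S₁ S₂ xbar ybar v₁ y = EMEP.secular D s v₁ y :=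
    fun y hy => EMEP.rootFun_eq_secular h₁ h₂ hP hdec hs hy
  have hg : ∀ y, 0 < y → EMEP.newtonMap (EMEP.rootFun S₁ S₂ xbar ybar v₁) y =
      y - EMEP.secular D s v₁ y / EMEP.secularDeriv D s y := by
    intro y hy
    -- The two functions agree only on `l ≥ 0`, but this contains a neighbourhood of `y > 0`, so the
    -- derivatives coincide.
    have hev : EMEP.rootFun S₁ S₂ xbar ybar v₁ =ᶠ[nhds y] EMEP.secular D s v₁ := by
      filter_upwards [Ioi_mem_nhds hy] with z hz using heq z (le_of_lt hz)
    rw [EMEP.newtonMap, heq y hy.le, hev.deriv_eq,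
      (EMEP.hasDerivAt_secular fun i => (add_pos (hD i) hy).ne').deriv]
  -- If `s = 0`, the secular function is the constant `-v₁ < 0`.
  have hs0 : ∀ y, 0 ≤ EMEP.secular D s v₁ y → s ≠ 0 := by
    rintro y hy rfl
    simp only [EMEP.secular, Pi.zero_apply, ne_eq, OfNat.ofNat_ne_zero, not_false_eq_true, zero_pow,
      zero_div, Finset.sum_const_zero, zero_sub] at hy
    linarith
  obtain ⟨hlam0, hfeas, hcompl⟩ := (EMEP.isMultiplier_iff h₁ h₂).1 hlam
  rw [heq lam hlam0] at hfeas hcompl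
  have hroot : 0 < lam → EMEP.secular D s v₁ lam = 0 := fun h =>
    (mul_eq_zero.1 hcompl).resolve_left h.ne'
  have hd' : (1 : ℝ) ≤ d := by exact_mod_cast hd
  have hG : 0 ≤ Real.log (1 + Real.log (b / δ)) :=
    Real.log_nonneg (by linarith [Real.log_nonneg ((one_le_div hδ).2 hδb)])
  have hcount : ∀ n : ℕ, (n : ℝ) ≤ 180 * d * (1 + Real.log (1 + Real.log (b / δ))) →
      (n : ℝ) ≤ 1440 * d * (1 + Real.log (1 + Real.log (b / δ))) ∧
      (4 * δ ≤ b → (n : ℝ) ≤ 1440 * d * Real.log (Real.log (b / δ))) := by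
    intro n hn
    refine ⟨hn.trans (by gcongr; norm_num), fun h => hn.trans ?_⟩
    calc 180 * d * (1 + Real.log (1 + Real.log (b / δ)))
        ≤ 180 * d * (8 * Real.log (Real.log (b / δ))) := by
          gcongr
          exact EMEP.one_add_log_le hδ h
      _ = _ := by ring
  refine ⟨fun a ha hal => ?_, ?_⟩
  · have hr := hroot (hδ.trans_le (ha.trans hal))
    obtain ⟨n, i, hrun, hi, herr, hn⟩ :=
      EMEP.runs_binarySearchNewton hd hD (hs0 _ hr.ge) hr hg hδ ha hal hlb
    obtain ⟨hn1, hn2⟩ := hcount n (hn.trans (by gcongr; norm_num))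
    exact ⟨_, n, hrun, herr, hn1, hn2, i, hi, rfl⟩
  · have htest := EMEP.runs_rootNotBelow (s := s) v₁ fun i => (add_pos (hD i) hδ).ne'
    by_cases hpos : 0 ≤ EMEP.secular D s v₁ δ
    · have hle : δ ≤ lam := by
        by_contra! hlt
        have := EMEP.secular_lt_secular (v := v₁)
          (fun i => add_pos_of_pos_of_nonneg (hD i) hlam0) (hs0 _ hpos) hlt
        linarith
      obtain ⟨n, i, hrun, -, herr, hn⟩ :=
        EMEP.runs_binarySearchNewton hd hD (hs0 _ hpos) (hroot (hδ.trans_le hle)) hg hδ le_rfl hle hlb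
      refine ⟨_, _, htest.bind (EMEP.runs_ite_pos (by simpa using hpos) hrun), herr, hcount _ ?_⟩
      push_cast
      nlinarith [mul_nonneg (zero_le_one.trans hd') hG]
    · have hlt : lam < δ := by
        by_contra! hle
        have hr := hroot (hδ.trans_le hle)
        exact hpos ((EMEP.secular_nonneg_iff hD (hs0 _ hr.ge) hlam0 hδ.le hr).2 hle)
      refine ⟨_, _, htest.bind (EMEP.runs_ite_neg (by simpa using hpos)
        ((EMEP.runs_const _).bind (EMEP.runs_div _ (by norm_num)))), ?_, hcount _ ?_⟩
      · rw [abs_lt]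
        push_cast
        constructor <;> linarith
      · push_cast
        nlinarith [mul_nonneg (zero_le_one.trans hd') hG]
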